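/- For a finite word $t_1\cdots t_n$ of positive integers, let $\mathcal O_{t_1\cdots t_n}$ be the word built in $n$ steps, starting from the empty word: in step $k$, append the letter $t_k$ to the current word, and then append $x_k-1$ further copies of $t_k$, where $x_k$ is the $k$-th letter of the word after $t_k$ has been appended (so that the $k$-th block has length $x_k$ and is filled with $t_k$). Each $\mathcal O_{t_1\cdots t_n}$ is a prefix of $\mathcal O_{t_1\cdots t_{n+1}}$ and has at least $n$ letters; for an infinite sequence $t=(t_n)_{n\ge1}$ of positive integers, the sequence $\mathcal O_t$ directed by $t$ is the infinite sequence of which all the words $\mathcal O_{t_1\cdots t_n}$ are prefixes. **Theorem.** Let $0<p<1$, and let $\mathbb T=(T_n)_{n\ge1}$ be a sequence of independent random variables with values in $\{1,2\}$ such that $\mathbb P(T_n=1)=p$ and $\mathbb P(T_n=2)=1-p$ for every $n\ge1$. Let $\mathbb X=(X_n)_{n\ge1}=\mathcal O_{\mathbb T}$ be the random sequence directed by $\mathbb T$, and let $|X_1\cdots X_n|_1$ be the number of indices $i\in\{1,\dots,n\}$ with $X_i=1$. Then $$\lim_{n\to\infty}\frac{|X_1\cdots X_n|_1}{n}=p\quad\text{almost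 surely.}$$ -/

import Mathlib

open MeasureTheory ProbabilityTheory Filter Topology

/-- One step of the construction, reading the letter `x` as the `k`-th letter (counted from `0`)
of the directing word: `x` is written at the end of the current word `X`, and then `X[k] - 1`
further copies of `x` are written, where `X[k]` is read in the word that already contains the
first copy of `x`. The `k`-th block thus has length `X[k]` and is filled with `x`.
(After `k` steps the current word has at least `k` letters, so that `X[k]` always exists.) -/
def directedStep (X : List ℕ) (k x : ℕ) : List ℕ :=
  (X ++ [x]) ++ List.replicate ((X ++ [x]).getD k 0 - 1) x

/-- The finite word `O_T` directed by the finite word `T`. -/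
def directedWord (T : List ℕ) : List ℕ :=
  T.zipIdx.foldl (fun X xk => directedStep X xk.2 xk.1) []

/-- The word `t_1 ⋯ t_n`; infinite sequences are indexed from `0`, so that `t i` is the
letter `t_{i+1}`. -/
def initialWord (t : ℕ → ℕ) (n : ℕ) : List ℕ := (List.range n).map t

theorem initialWord_succ (t : ℕ → ℕ) (n : ℕ) :
    initialWord t (n + 1) = initialWord t n ++ [t n] := by
  simp [initialWord, List.range_succ]

theorem directedWord_append_singleton (T : List ℕ) (x : ℕ) :
    directedWord (T ++ [x]) = directedStep (directedWord T) T.length x := by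
  simp [directedWord, List.zipIdx_append]

theorem directedWord_initialWord_succ (t : ℕ → ℕ) (n : ℕ) :
    directedWord (initialWord t (n + 1)) = directedStep (directedWord (initialWord t n)) n (t n) := by
  rw [initialWord_succ, directedWord_append_singleton]
  simp [initialWord]

/-- `O_{t_1 ⋯ t_m}` is a prefix of `O_{t_1 ⋯ t_n}` for `m ≤ n`. -/
theorem directedWord_prefix (t : ℕ → ℕ) {m n : ℕ} (h : m ≤ n) :
    directedWord (initialWord t m) <+: directedWord (initialWord t n) := by
  induction n, h using Nat.le_induction with
  | base => exact List.prefix_rfl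
  | succ n _ ih =>
    rw [directedWord_initialWord_succ, directedStep, List.append_assoc]
    exact ih.trans (List.prefix_append _ _)

theorem le_length_directedWord (t : ℕ → ℕ) (n : ℕ) :
    n ≤ (directedWord (initialWord t n)).length := by
  induction n with
  | zero => simp
  | succ n ih =>
    rw [directedWord_initialWord_succ, directedStep]
    simp only [List.length_append, List.length_singleton]
    omega

/-- The infinite sequence `O_T` directed by the infinite sequence `t`: the limit of the words
`O_{t_1 ⋯ t_n}`, each of which is a prefix of the next. Its letter of index `n` (counted from `0`)
is read in `O_{t_1 ⋯ t_{n+1}}`, which has at least `n + 1` letters. -/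
def directedSeq (t : ℕ → ℕ) (n : ℕ) : ℕ :=
  (directedWord (initialWord t (n + 1)))[n]'(le_length_directedWord t (n + 1))

/-- Every `O_{t_1 ⋯ t_k}` is an initial word of the directed sequence, so that the latter
is indeed the limit. -/
theorem directedWord_eq_initialWord_directedSeq (t : ℕ → ℕ) (k : ℕ) :
    directedWord (initialWord t k) =
      initialWord (directedSeq t) (directedWord (initialWord t k)).length := by
  apply List.ext_getElem
  · simp [initialWord]
  · intro i h₁ h₂
    have h₃ := le_length_directedWord t (i + 1)
    simp only [initialWord, List.getElem_map, List.getElem_range]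
    rcases le_total k (i + 1) with h | h
    · exact (directedWord_prefix t h).getElem h₁
    · exact ((directedWord_prefix t h).getElem h₃).symm

/-! Let W_n be the word after n steps. If W_n has more than n letters, the length of block n can
already be read in W_n, so it is independent of the letter T_n that fills the block. Hence (number
of ones) - p * (length) of W_n is, up to an error at most 1, a martingale `fluctuation` with
increments bounded by 2. Its increments are orthogonal, so its second moment at time n is at most
4n. Along the squares n = m^2 the second moments of `fluctuation` / n are summable, which gives
almost sure convergence to 0 there; bounded increments fill the gaps. An arbitrary prefix of the
sequence differs from some W_k by at most one letter. -/

/-- The length of the `n`-th block of the directed sequence, as predicted by the first `n` letters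
of the directing sequence `t`, and truncated at `2`. -/
def predictedLength (t : ℕ → ℕ) (n : ℕ) : ℕ :=
  min ((directedWord (initialWord t n)).getD n 1) 2

/-- The sum of the first `n` centred letter indicators, weighted by the predicted block lengths. -/
noncomputable def fluctuation (p : ℝ) (t : ℕ → ℕ) (n : ℕ) : ℝ :=
  ∑ k ∈ Finset.range n, (predictedLength t k : ℝ) * ((if t k = 1 then 1 else 0) - p)

theorem fluctuation_succ (p : ℝ) (t : ℕ → ℕ) (n : ℕ) :
    fluctuation p t (n + 1) = fluctuation p t n +
      (predictedLength t n : ℝ) * ((if t n = 1 then 1 else 0) - p) :=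
  Finset.sum_range_succ _ _

/-! ### Predictability and bounded increments -/

theorem initialWord_congr {s t : ℕ → ℕ} {n : ℕ} (h : ∀ i < n, s i = t i) :
    initialWord s n = initialWord t n :=
  List.map_congr_left fun i hi => h i (List.mem_range.1 hi)

theorem predictedLength_congr {s t : ℕ → ℕ} {n : ℕ} (h : ∀ i < n, s i = t i) :
    predictedLength s n = predictedLength t n := by
  rw [predictedLength, predictedLength, initialWord_congr h]

theorem fluctuation_congr (p : ℝ) {s t : ℕ → ℕ} {n : ℕ} (h : ∀ i < n, s i = t i) :
    fluctuation p s n = fluctuation p t n := by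
  refine Finset.sum_congr rfl fun k hk => ?_
  have hk := Finset.mem_range.1 hk
  rw [predictedLength_congr fun i hi => h i (hi.trans hk), h k hk]

theorem predictedLength_le_two (t : ℕ → ℕ) (n : ℕ) : (predictedLength t n : ℝ) ≤ 2 :=
  mod_cast min_le_right _ _

/-- The truncation at 2 makes this hold for every `t`, not only on the almost sure event where all
letters are 1 or 2; integrability then comes from a uniform bound. -/
theorem abs_increment_le {p : ℝ} (hp0 : 0 ≤ p) (hp1 : p ≤ 1) (t : ℕ → ℕ) (n : ℕ) :
    |(predictedLength t n : ℝ) * ((if t n = 1 then 1 else 0) - p)| ≤ 2 := by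
  have h1 : |(if t n = 1 then (1 : ℝ) else 0) - p| ≤ 1 := by
    rw [abs_le]; split_ifs <;> constructor <;> linarith
  rw [abs_mul, Nat.abs_cast]
  calc _ ≤ (2 : ℝ) * 1 := mul_le_mul (predictedLength_le_two t n) h1 (abs_nonneg _) (by norm_num)
    _ = 2 := by norm_num

theorem abs_fluctuation_add_sub_le {p : ℝ} (hp0 : 0 ≤ p) (hp1 : p ≤ 1) (t : ℕ → ℕ) (m j : ℕ) :
    |fluctuation p t (m + j) - fluctuation p t m| ≤ 2 * j := by
  induction j with
  | zero => simp
  | succ j ih =>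
    rw [← add_assoc, fluctuation_succ]
    have h := abs_increment_le hp0 hp1 t (m + j)
    rw [abs_le] at *
    push_cast
    constructor <;> linarith [ih.1, ih.2, h.1, h.2]

theorem abs_fluctuation_le {p : ℝ} (hp0 : 0 ≤ p) (hp1 : p ≤ 1) (t : ℕ → ℕ) (n : ℕ) :
    |fluctuation p t n| ≤ 2 * n := by
  simpa [fluctuation] using abs_fluctuation_add_sub_le hp0 hp1 t 0 n

/-! ### Counting ones through the fluctuation -/

section Deterministic

variable {t : ℕ → ℕ}

theorem directedWord_succ_eq_append_replicate (ht : ∀ i, t i = 1 ∨ t i = 2) (n : ℕ) :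
    (∀ a ∈ directedWord (initialWord t n), a = 1 ∨ a = 2) ∧
    ∃ x, (x = 1 ∨ x = 2) ∧ x = (directedWord (initialWord t n) ++ [t n]).getD n 0 ∧
      directedWord (initialWord t (n + 1)) =
        directedWord (initialWord t n) ++ List.replicate x (t n) := by
  have step (hn : ∀ a ∈ directedWord (initialWord t n), a = 1 ∨ a = 2) :
      ∃ x, (x = 1 ∨ x = 2) ∧ x = (directedWord (initialWord t n) ++ [t n]).getD n 0 ∧
      directedWord (initialWord t (n + 1)) =
        directedWord (initialWord t n) ++ List.replicate x (t n) := by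
    have hlen : n < (directedWord (initialWord t n) ++ [t n]).length := by
      have := le_length_directedWord t n
      simp only [List.length_append, List.length_singleton]
      omega
    have hx : (directedWord (initialWord t n) ++ [t n]).getD n 0 = 1 ∨
        (directedWord (initialWord t n) ++ [t n]).getD n 0 = 2 := by
      rw [List.getD_eq_getElem _ _ hlen]
      have hmem := List.getElem_mem hlen
      rw [List.mem_append, List.mem_singleton] at hmem
      rcases hmem with h | h
      · exact hn _ h
      · rw [h]; exact ht n
    refine ⟨_, hx, rfl, ?_⟩
    rw [directedWord_initialWord_succ, directedStep, List.append_assoc]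
    rcases hx with h | h <;> rw [h] <;> rfl
  suffices hn : ∀ a ∈ directedWord (initialWord t n), a = 1 ∨ a = 2 from ⟨hn, step hn⟩
  clear step
  induction n with
  | zero => simp [initialWord, directedWord]
  | succ n ih =>
    rw [directedWord_initialWord_succ, directedStep]
    intro a ha
    simp only [List.mem_append, List.mem_singleton, List.mem_replicate] at ha
    rcases ha with (h | h) | h
    · exact ih a h
    · rw [h]; exact ht n
    · rw [h.2]; exact ht n

/-- The prediction is wrong at most once: while all letters are 1 the word has exactly `n` letters
and the block length is `t n` itself. The first 2 creates a block of length 2 instead of the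
predicted 1, an error of -p; from then on the word stays ahead of the reading position. -/
theorem abs_count_sub_fluctuation_le {p : ℝ} (hp0 : 0 ≤ p) (hp1 : p ≤ 1)
    (ht : ∀ i, t i = 1 ∨ t i = 2) (n : ℕ) :
    |((directedWord (initialWord t n)).count 1 : ℝ) - p * (directedWord (initialWord t n)).length
      - fluctuation p t n| ≤ 1 := by
  suffices h : ((directedWord (initialWord t n)).length = n ∧
      ((directedWord (initialWord t n)).count 1 : ℝ)
        - p * (directedWord (initialWord t n)).length - fluctuation p t n = 0) ∨
      (n < (directedWord (initialWord t n)).length ∧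
      |((directedWord (initialWord t n)).count 1 : ℝ)
        - p * (directedWord (initialWord t n)).length - fluctuation p t n| ≤ 1) by
    rcases h with h | h
    · rw [h.2]; simp
    · exact h.2
  induction n with
  | zero => left; simp [initialWord, directedWord, fluctuation]
  | succ n ih =>
    obtain ⟨hmem, x, hx, hxd, hw⟩ := directedWord_succ_eq_append_replicate ht n
    rw [hw, fluctuation_succ]
    simp only [List.count_append, List.length_append, List.length_replicate, List.count_replicate,
      beq_iff_eq]
    rcases ih with ⟨hl, h0⟩ | ⟨hl, h0⟩
    · have hpl : predictedLength t n = 1 := by simp [predictedLength, hl]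
      have hxt : x = t n := by
        rw [hxd]
        simp [List.getD_eq_getElem?_getD, hl]
      rw [hpl, hl]
      rw [hl] at h0
      rcases ht n with h | h
      · left
        rw [hxt, h]
        refine ⟨rfl, ?_⟩
        push_cast
        norm_num
        linarith
      · right
        rw [hxt, h]
        refine ⟨by omega, ?_⟩
        push_cast
        norm_num
        rw [abs_le]
        constructor <;> linarith
    · right
      have hpl : predictedLength t n = x := by
        rw [List.getD_append _ _ _ _ hl, List.getD_eq_getElem _ _ hl] at hxd
        rw [predictedLength, List.getD_eq_getElem _ _ hl, ← hxd]
        omega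
      refine ⟨by omega, ?_⟩
      rw [hpl]
      convert h0 using 2
      split_ifs <;> push_cast <;> ring

theorem count_initialWord_add (s : ℕ → ℕ) (m j : ℕ) :
    (initialWord s m).count 1 ≤ (initialWord s (m + j)).count 1 ∧
      (initialWord s (m + j)).count 1 ≤ (initialWord s m).count 1 + j := by
  induction j with
  | zero => simp
  | succ j ih =>
    rw [← add_assoc, initialWord_succ, List.count_append, List.count_singleton]
    split_ifs <;> omega

/-- The constant 3 is 1 for the misprediction, plus 1 for the count and 1 for `p * j` when the
prefix ends `j ≤ 1` letters into block `k`. -/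
theorem exists_abs_count_sub_le {p : ℝ} (hp0 : 0 ≤ p) (hp1 : p ≤ 1)
    (ht : ∀ i, t i = 1 ∨ t i = 2) (n : ℕ) :
    ∃ k ≤ n, |((initialWord (directedSeq t) n).count 1 : ℝ) - p * n|
      ≤ |fluctuation p t k| + 3 := by
  have hex : ∃ k, n < (directedWord (initialWord t (k + 1))).length :=
    ⟨n, le_length_directedWord t (n + 1)⟩
  classical
  -- Block `k` is the one containing the letter of index `n`.
  set k := Nat.find hex with hk
  have hlt : n < (directedWord (initialWord t (k + 1))).length := Nat.find_spec hex
  have hle : (directedWord (initialWord t k)).length ≤ n := by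
    rcases Nat.eq_zero_or_pos k with h | h
    · rw [h]; simp [initialWord, directedWord]
    · have := Nat.find_min hex (m := k - 1) (by omega)
      rw [Nat.sub_add_cancel h] at this
      omega
  have hlk := le_length_directedWord t k
  refine ⟨k, by omega, ?_⟩
  obtain ⟨-, x, hx, -, hw⟩ := directedWord_succ_eq_append_replicate ht k
  rw [hw, List.length_append, List.length_replicate] at hlt
  have hM := abs_count_sub_fluctuation_le hp0 hp1 ht k
  rw [congrArg (List.count 1) (directedWord_eq_initialWord_directedSeq t k)] at hM
  obtain ⟨j, hj⟩ := Nat.exists_eq_add_of_le hle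
  have hj1 : (j : ℝ) ≤ 1 := by
    have : j ≤ 1 := by omega
    exact_mod_cast this
  have hj0 : (0 : ℝ) ≤ j := Nat.cast_nonneg j
  have hc := count_initialWord_add (directedSeq t) (directedWord (initialWord t k)).length j
  rw [hj]
  have hc1 : ((initialWord (directedSeq t) (directedWord (initialWord t k)).length).count 1 : ℝ)
      ≤ ((initialWord (directedSeq t)
        ((directedWord (initialWord t k)).length + j)).count 1 : ℝ) := mod_cast hc.1
  have hc2 : ((initialWord (directedSeq t)
        ((directedWord (initialWord t k)).length + j)).count 1 : ℝ) ≤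
      ((initialWord (directedSeq t) (directedWord (initialWord t k)).length).count 1 : ℝ) + j :=
    mod_cast hc.2
  have hpj0 : 0 ≤ p * j := mul_nonneg hp0 hj0
  have hpj1 : p * j ≤ 1 := mul_le_one₀ hp1 hj0 hj1
  push_cast
  rw [mul_add]
  rw [abs_le] at hM ⊢
  have ha := neg_abs_le (fluctuation p t k)
  have hb := le_abs_self (fluctuation p t k)
  constructor <;> linarith [hM.1, hM.2]

end Deterministic

/-! ### Passage to the limit -/

/-- An affine bound valid for all `m` can be applied at a block index `k ≤ n` without knowing that
`k` tends to infinity. -/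
theorem exists_le_mul_add_of_tendsto_div {u : ℕ → ℝ}
    (hu : Tendsto (fun m => u m / m) atTop (𝓝 0)) {ε : ℝ} (hε : 0 < ε) :
    ∃ C, 0 ≤ C ∧ ∀ m, |u m| ≤ ε * m + C := by
  obtain ⟨N, hN⟩ := Metric.tendsto_atTop.1 hu ε hε
  refine ⟨∑ i ∈ Finset.range (N + 1), |u i|, Finset.sum_nonneg fun _ _ => abs_nonneg _,
    fun m => ?_⟩
  rcases Nat.lt_or_ge m (N + 1) with h | h
  · have := Finset.single_le_sum (f := fun i => |u i|) (fun i _ => abs_nonneg _)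
      (Finset.mem_range.2 h)
    have h2 : 0 ≤ ε * m := by positivity
    linarith
  · have h1 := hN m (by omega)
    have hm : (0 : ℝ) < m := by
      have : 0 < m := by omega
      exact_mod_cast this
    rw [Real.dist_eq, sub_zero, abs_div, abs_of_pos hm, div_lt_iff₀ hm] at h1
    have : 0 ≤ ∑ i ∈ Finset.range (N + 1), |u i| := Finset.sum_nonneg fun _ _ => abs_nonneg _
    linarith

theorem tendsto_fluctuation_div {p : ℝ} (hp0 : 0 ≤ p) (hp1 : p ≤ 1) (t : ℕ → ℕ)
    (h : Tendsto (fun m : ℕ => fluctuation p t (m ^ 2) / (m : ℝ) ^ 2) atTop (𝓝 0)) :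
    Tendsto (fun n : ℕ => fluctuation p t n / n) atTop (𝓝 0) := by
  have hsqrt : Tendsto Nat.sqrt atTop atTop :=
    tendsto_atTop_atTop.2 fun b => ⟨b * b, fun a ha => Nat.le_sqrt.2 ha⟩
  have hlim : Tendsto (fun n : ℕ => |fluctuation p t (n.sqrt ^ 2) / (n.sqrt : ℝ) ^ 2|
      + 4 / (n.sqrt : ℝ)) atTop (𝓝 0) := by
    have h1 := (h.abs).comp hsqrt
    have h2 := (tendsto_const_div_atTop_nhds_zero_nat (4 : ℝ)).comp hsqrt
    simpa using h1.add h2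
  refine squeeze_zero_norm' ?_ hlim
  filter_upwards [eventually_ge_atTop 1] with n hn
  set m := n.sqrt with hm
  have hm1 : 0 < m := Nat.sqrt_pos.2 hn
  have hmn : m ^ 2 ≤ n := Nat.sqrt_le' n
  have hnm : n ≤ m * m + m + m := Nat.sqrt_le_add n
  obtain ⟨j, hj⟩ := Nat.exists_eq_add_of_le hmn
  -- Consecutive squares are `2 * m + 1` apart, so the fluctuation moves by at most `4 * m` after `m
  -- ^ 2`.
  have hj2 : j ≤ 2 * m := by nlinarith
  have hd := abs_fluctuation_add_sub_le hp0 hp1 t (m ^ 2) j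
  rw [← hj] at hd
  have hmR : (0 : ℝ) < m := mod_cast hm1
  have hnR : (m : ℝ) ^ 2 ≤ n := mod_cast hmn
  have hjR : (j : ℝ) ≤ 2 * m := mod_cast hj2
  have habs : |fluctuation p t n| ≤ |fluctuation p t (m ^ 2)| + 4 * m := by
    have := abs_sub_abs_le_abs_sub (fluctuation p t n) (fluctuation p t (m ^ 2))
    linarith
  rw [Real.norm_eq_abs, abs_div, abs_div, Nat.abs_cast, abs_of_pos (by positivity : (0 : ℝ) < m ^ 2)]
  calc |fluctuation p t n| / n ≤ (|fluctuation p t (m ^ 2)| + 4 * m) / (m : ℝ) ^ 2 := by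
        gcongr
    _ = _ := by field_simp

theorem tendsto_count_div {p : ℝ} (hp0 : 0 ≤ p) (hp1 : p ≤ 1) {t : ℕ → ℕ}
    (ht : ∀ i, t i = 1 ∨ t i = 2)
    (h : Tendsto (fun n : ℕ => fluctuation p t n / n) atTop (𝓝 0)) :
    Tendsto (fun n : ℕ => ((initialWord (directedSeq t) n).count 1 : ℝ) / (n : ℝ))
      atTop (𝓝 p) := by
  rw [Metric.tendsto_atTop]
  intro ε hε
  obtain ⟨C, hC0, hC⟩ := exists_le_mul_add_of_tendsto_div h (half_pos hε)
  obtain ⟨N, hN⟩ := exists_nat_gt ((C + 3) / (ε / 2))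
  refine ⟨N + 1, fun n hn => ?_⟩
  have hn0 : (0 : ℝ) < n := by
    have : 0 < n := by omega
    exact_mod_cast this
  have hNn : (N : ℝ) ≤ n := by
    have : N ≤ n := by omega
    exact_mod_cast this
  obtain ⟨k, hkn, hk⟩ := exists_abs_count_sub_le hp0 hp1 ht n
  have hkR : (k : ℝ) ≤ n := mod_cast hkn
  have h1 : (C + 3) < n * (ε / 2) := (div_lt_iff₀ (half_pos hε)).1 (hN.trans_le hNn)
  have h2 : ε / 2 * k ≤ ε / 2 * n := by gcongr
  have h3 : ((initialWord (directedSeq t) n).count 1 : ℝ) / n - p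
      = (((initialWord (directedSeq t) n).count 1 : ℝ) - p * n) / n := by field_simp
  rw [Real.dist_eq, h3, abs_div, Nat.abs_cast, div_lt_iff₀ hn0]
  linarith [hC k]

/-! ### Second moments and almost sure convergence -/

/-- A function depending only on the first `n` letters factors through the restriction to them. -/
theorem exists_eq_comp_restrict_range {F : (ℕ → ℕ) → ℝ} {n : ℕ}
    (hF : ∀ s t : ℕ → ℕ, (∀ i < n, s i = t i) → F s = F t) :
    ∃ g : (Finset.range n → ℕ) → ℝ, ∀ t, F t = g fun i => t i := by
  classical
  refine ⟨fun v => F fun i => if h : i ∈ Finset.range n then v ⟨i, h⟩ else 0, fun t => ?_⟩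
  refine hF _ _ fun i hi => ?_
  simp [hi]

section Probability

variable {Ω : Type*} [MeasurableSpace Ω] {μ : Measure Ω} {T : ℕ → Ω → ℕ}

theorem measurable_of_dependsOn_range (hT : ∀ n, Measurable (T n)) {F : (ℕ → ℕ) → ℝ} {n : ℕ}
    (hF : ∀ s t : ℕ → ℕ, (∀ i < n, s i = t i) → F s = F t) :
    Measurable fun ω => F fun i => T i ω := by
  obtain ⟨g, hg⟩ := exists_eq_comp_restrict_range hF
  simp_rw [hg]
  exact (Measurable.of_discrete (f := g)).comp (measurable_pi_lambda _ fun i => hT i)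

theorem indepFun_of_dependsOn_range (hT : ∀ n, Measurable (T n)) (hind : iIndepFun T μ)
    {F : (ℕ → ℕ) → ℝ} {n : ℕ} (hF : ∀ s t : ℕ → ℕ, (∀ i < n, s i = t i) → F s = F t)
    (G : ℕ → ℝ) : IndepFun (fun ω => F fun i => T i ω) (fun ω => G (T n ω)) μ := by
  obtain ⟨g, hg⟩ := exists_eq_comp_restrict_range hF
  simp_rw [hg]
  have h := hind.indepFun_finset (Finset.range n) {n} (by simp) hT
  exact h.comp (φ := g) (ψ := fun v => G (v ⟨n, Finset.mem_singleton_self n⟩))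
    Measurable.of_discrete Measurable.of_discrete

theorem measurable_fluctuation (hT : ∀ n, Measurable (T n)) (p : ℝ) (n : ℕ) :
    Measurable fun ω => fluctuation p (fun i => T i ω) n :=
  measurable_of_dependsOn_range (F := fun t => fluctuation p t n) hT
    fun _ _ h => fluctuation_congr p h

theorem integrable_fluctuation_sq [IsProbabilityMeasure μ] (hT : ∀ n, Measurable (T n))
    {p : ℝ} (hp0 : 0 ≤ p) (hp1 : p ≤ 1) (n : ℕ) :
    Integrable (fun ω => fluctuation p (fun i => T i ω) n ^ 2) μ := by
  refine Integrable.of_bound ((measurable_fluctuation hT p n).pow_const 2).aestronglyMeasurable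
    ((2 * n) ^ 2) (Eventually.of_forall fun ω => ?_)
  rw [norm_pow, Real.norm_eq_abs]
  exact pow_le_pow_left₀ (abs_nonneg _) (abs_fluctuation_le hp0 hp1 _ n) 2

theorem integral_fluctuation_sq_le [IsProbabilityMeasure μ] (hT : ∀ n, Measurable (T n))
    (hind : iIndepFun T μ) {p : ℝ} (hp0 : 0 ≤ p) (hp1 : p ≤ 1)
    (hone : ∀ n, μ {ω | T n ω = 1} = ENNReal.ofReal p) (n : ℕ) :
    ∫ ω, fluctuation p (fun i => T i ω) n ^ 2 ∂μ ≤ 4 * n := by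
  induction n with
  | zero => simp [fluctuation]
  | succ n ih =>
    set G : ℕ → ℝ := fun a => (if a = 1 then 1 else 0) - p with hG
    set F : (ℕ → ℕ) → ℝ := fun t => fluctuation p t n * predictedLength t n with hFdef
    have hF : ∀ s t : ℕ → ℕ, (∀ i < n, s i = t i) → F s = F t := fun s t h => by
      simp only [hFdef, fluctuation_congr p h, predictedLength_congr h]
    have hFm := measurable_of_dependsOn_range hT hF
    have hGm : Measurable fun ω => G (T n ω) := (Measurable.of_discrete (f := G)).comp (hT n)
    have hGint : ∫ ω, G (T n ω) ∂μ = 0 := by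
      have hms : MeasurableSet {ω | T n ω = 1} := hT n (measurableSet_singleton 1)
      have heq : (fun ω => if T n ω = 1 then (1 : ℝ) else 0) =
          Set.indicator {ω | T n ω = 1} 1 := by
        ext ω; simp [Set.indicator_apply]
      simp only [hG]
      rw [integral_sub _ (integrable_const p), heq, integral_indicator_one hms]
      · simp [Measure.real, hone, ENNReal.toReal_ofReal hp0]
      · rw [heq]
        exact (integrable_const (1 : ℝ)).indicator hms
    -- Orthogonality of increments: `F` depends only on the first `n` letters, and `G` of the next
    -- letter is centred.
    have hprod : ∫ ω, F (fun i => T i ω) * G (T n ω) ∂μ = 0 := by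
      rw [(indepFun_of_dependsOn_range hT hind hF G).integral_fun_mul_eq_mul_integral
        hFm.aestronglyMeasurable hGm.aestronglyMeasurable, hGint, mul_zero]
    have hcross (ω : Ω) : |F (fun i => T i ω) * G (T n ω)| ≤ 2 * n * 2 := by
      simp only [hFdef, hG]
      rw [mul_assoc, abs_mul]
      exact mul_le_mul (abs_fluctuation_le hp0 hp1 _ n)
        (abs_increment_le hp0 hp1 (fun i => T i ω) n) (abs_nonneg _) (by positivity)
    have hcrossInt : Integrable (fun ω => F (fun i => T i ω) * G (T n ω)) μ :=
      Integrable.of_bound (hFm.mul hGm).aestronglyMeasurable (2 * n * 2)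
        (Eventually.of_forall hcross)
    have hsumInt : Integrable (fun ω => fluctuation p (fun i => T i ω) n ^ 2 +
        2 * (F (fun i => T i ω) * G (T n ω))) μ :=
      (integrable_fluctuation_sq hT hp0 hp1 n).add (hcrossInt.const_mul 2)
    have hle : ∫ ω, fluctuation p (fun i => T i ω) (n + 1) ^ 2 ∂μ ≤
        ∫ ω, (fluctuation p (fun i => T i ω) n ^ 2 + 2 * (F (fun i => T i ω) * G (T n ω)) + 4) ∂μ := by
      refine integral_mono (integrable_fluctuation_sq hT hp0 hp1 (n + 1))
        (hsumInt.add (integrable_const 4)) fun ω => ?_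
      have h4 := sq_le_sq' (abs_le.1 (abs_increment_le hp0 hp1 (fun i => T i ω) n)).1
        (abs_le.1 (abs_increment_le hp0 hp1 (fun i => T i ω) n)).2
      simp only [fluctuation_succ, hFdef, hG]
      linarith
    rw [integral_add hsumInt (integrable_const 4),
      integral_add (integrable_fluctuation_sq hT hp0 hp1 n)
      (hcrossInt.const_mul 2), integral_const_mul, hprod] at hle
    simp only [integral_const, probReal_univ, smul_eq_mul] at hle
    push_cast
    linarith

/-- By Tonelli the series of squares has finite integral, so it converges almost everywhere and its
terms tend to 0. -/
theorem ae_tendsto_zero_of_summable_integral_sq {f : ℕ → Ω → ℝ}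
    (hf : ∀ n, Integrable (fun ω => f n ω ^ 2) μ)
    (hs : Summable fun n => ∫ ω, f n ω ^ 2 ∂μ) :
    ∀ᵐ ω ∂μ, Tendsto (fun n => f n ω) atTop (𝓝 0) := by
  have hfin : ∑' n, ∫⁻ ω, ENNReal.ofReal (f n ω ^ 2) ∂μ ≠ ⊤ := by
    have (n : ℕ) : ∫⁻ ω, ENNReal.ofReal (f n ω ^ 2) ∂μ = ENNReal.ofReal (∫ ω, f n ω ^ 2 ∂μ) :=
      (ofReal_integral_eq_lintegral_ofReal (hf n)
        (Eventually.of_forall fun ω => sq_nonneg _)).symm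
    simp_rw [this]
    exact hs.tsum_ofReal_ne_top
  rw [← lintegral_tsum fun n => (hf n).aemeasurable.ennreal_ofReal] at hfin
  filter_upwards [ae_lt_top' (AEMeasurable.tsum
    fun n => (hf n).aemeasurable.ennreal_ofReal) hfin] with ω hω
  have h1 := (ENNReal.tendsto_toReal ENNReal.zero_ne_top).comp
    (ENNReal.tendsto_atTop_zero_of_tsum_ne_top hω.ne)
  have h2 : Tendsto (fun n => f n ω ^ 2) atTop (𝓝 0) := by
    refine h1.congr fun n => ?_
    simp [ENNReal.toReal_ofReal (sq_nonneg (f n ω))]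
  have h3 := h2.sqrt
  simp only [Real.sqrt_sq_eq_abs, Real.sqrt_zero] at h3
  exact (tendsto_zero_iff_abs_tendsto_zero _).2 h3

theorem ae_tendsto_fluctuation_div [IsProbabilityMeasure μ] (hT : ∀ n, Measurable (T n))
    (hind : iIndepFun T μ) {p : ℝ} (hp0 : 0 ≤ p) (hp1 : p ≤ 1)
    (hone : ∀ n, μ {ω | T n ω = 1} = ENNReal.ofReal p) :
    ∀ᵐ ω ∂μ, Tendsto (fun n : ℕ => fluctuation p (fun i => T i ω) n / n) atTop (𝓝 0) := by
  have h := ae_tendsto_zero_of_summable_integral_sq (μ := μ)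
    (f := fun m ω => fluctuation p (fun i => T i ω) (m ^ 2) / (m : ℝ) ^ 2) ?_ ?_
  · filter_upwards [h] with ω hω
    exact tendsto_fluctuation_div hp0 hp1 _ hω
  · intro m
    simp_rw [div_pow]
    exact (integrable_fluctuation_sq hT hp0 hp1 (m ^ 2)).div_const _
  · refine Summable.of_nonneg_of_le (fun m => integral_nonneg fun ω => sq_nonneg _) (fun m => ?_)
      ((Real.summable_one_div_nat_pow.2 one_lt_two).mul_left 4)
    simp_rw [div_pow]
    rw [integral_div]
    have hm := integral_fluctuation_sq_le hT hind hp0 hp1 hone (m ^ 2)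
    rcases Nat.eq_zero_or_pos m with rfl | hpos
    · simp
    · have hmR : (0 : ℝ) < m := mod_cast hpos
      rw [div_le_iff₀ (by positivity)]
      refine hm.trans (le_of_eq ?_)
      push_cast
      field_simp

theorem ae_eq_one_or_eq_two [IsProbabilityMeasure μ] (hT : ∀ n, Measurable (T n))
    {p : ℝ} (hp0 : 0 ≤ p) (hp1 : p ≤ 1)
    (hone : ∀ n, μ {ω | T n ω = 1} = ENNReal.ofReal p)
    (htwo : ∀ n, μ {ω | T n ω = 2} = ENNReal.ofReal (1 - p)) :
    ∀ᵐ ω ∂μ, ∀ n, T n ω = 1 ∨ T n ω = 2 := by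
  rw [ae_all_iff]
  intro n
  have h1 : MeasurableSet {ω | T n ω = 1} := hT n (measurableSet_singleton 1)
  have h2 : MeasurableSet {ω | T n ω = 2} := hT n (measurableSet_singleton 2)
  have hd : Disjoint {ω | T n ω = 1} {ω | T n ω = 2} :=
    Set.disjoint_left.2 fun ω (ha : T n ω = 1) (hb : T n ω = 2) => by omega
  have hu : μ ({ω | T n ω = 1} ∪ {ω | T n ω = 2}) = 1 := by
    rw [measure_union hd h2, hone, htwo, ← ENNReal.ofReal_add hp0 (by linarith)]
    simp
  exact (mem_ae_iff_prob_eq_one (h1.union h2)).2 hu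

end Probability

theorem mainTheorem1 {Ω : Type*} [MeasurableSpace Ω] (μ : Measure Ω) [IsProbabilityMeasure μ]
    (p : ℝ) (hp0 : 0 < p) (hp1 : p < 1)
    (T : ℕ → Ω → ℕ) (hT_meas : ∀ n, Measurable (T n)) (hT_indep : iIndepFun T μ)
    (hT_one : ∀ n, μ {ω | T n ω = 1} = ENNReal.ofReal p)
    (hT_two : ∀ n, μ {ω | T n ω = 2} = ENNReal.ofReal (1 - p)) :
    ∀ᵐ ω ∂μ, Tendsto
      (fun n : ℕ =>
        ((initialWord (directedSeq fun i => T i ω) n).count 1 : ℝ) / (n : ℝ))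
      atTop (𝓝 p) := by
  filter_upwards [ae_tendsto_fluctuation_div hT_meas hT_indep hp0.le hp1.le hT_one,
    ae_eq_one_or_eq_two hT_meas hp0.le hp1.le hT_one hT_two] with ω hlim hT
  exact tendsto_count_div hp0.le hp1.le hT hlim
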